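/- Let $\mathcal N=\{1,\dots,n\}$ be a finite set of products and $\mathcal S$ a collection of assortments $S\subseteq\mathcal N$, let $\mathcal I_{\mathcal S}=\{(i,S): S\in\mathcal S,\ i\in S\}$, and let $\boldsymbol p_{\mathcal S}=(p_{i,S})_{(i,S)\in\mathcal I_{\mathcal S}}$ be choice data, i.e. $\boldsymbol p_S=(p_{i,S})_{i\in S}$ lies in the probability simplex $\Delta_S=\{x\in\mathbb R^S: x_i\ge 0,\ \sum_{i\in S}x_i=1\}$ for every $S\in\mathcal S$. A marginal distribution model (MDM) is given by deterministic utilities $\nu_1,\dots,\nu_n\in\mathbb R$ and marginal distributions $F_1,\dots,F_n$ of random terms $\tilde\epsilon_1,\dots,\tilde\epsilon_n$, where each $F_i$ is absolutely continuous, strictly increasing on its support, and satisfies $\mathbb E|\tilde\epsilon_i|<\infty$. Let $\Theta$ be the set of joint distributions of $(\tilde\epsilon_1,\dots,\tilde\epsilon_n)$ with marginals $F_1,\dots,F_n$. The choice probability of $i\in S$ is the probability that $i=\arg\max_{j\in S}(\nu_j+\tilde\epsilon_j)$ under a $\theta^*\in\Theta$ that maximizes $\mathbb E_\theta[\max_{j\in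 S}(\nu_j+\tilde\epsilon_j)]$ over $\theta\in\Theta$. Let $\mathcal P_{\mathrm{MDM}}(\mathcal S)\subseteq\mathbb R^{\mathcal I_{\mathcal S}}$ be the set of all $\boldsymbol x_{\mathcal S}=(x_{i,S})$ for which some MDM (the same for all $S\in\mathcal S$) has choice probabilities $x_{i,S}$ for all $(i,S)\in\mathcal I_{\mathcal S}$. Let $\mathrm{loss}(\boldsymbol p_{\mathcal S},\boldsymbol x_{\mathcal S})=\sum_{S\in\mathcal S}\mathrm{loss}_S(\boldsymbol p_S,\boldsymbol x_S)$, where each $\boldsymbol x_S\mapsto\mathrm{loss}_S(\boldsymbol p_S,\boldsymbol x_S)\in[0,\infty]$ is continuous on $\Delta_S$, and define the limit of MDM by $\mathcal L(\boldsymbol p_{\mathcal S})=\inf\{\mathrm{loss}(\boldsymbol p_{\mathcal S},\boldsymbol x_{\mathcal S}):\boldsymbol x_{\mathcal S}\in\mathcal P_{\mathrm{MDM}}(\mathcal S)\}$. Consider the following constraints on $\boldsymbol x_{\mathcal S}\in\mathbb R^{\mathcal I_{\mathcal S}}$ and $\boldsymbol\lambda\in\mathbb R^{\mathcal S}$: $$x_{i,S}\ge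 x_{i,T}\ \text{ if }\ \lambda_S\le\lambda_T\quad\forall (i,S),(i,T)\in\mathcal I_{\mathcal S},\qquad \sum_{i\in S}x_{i,S}=1\quad\forall S\in\mathcal S,\qquad x_{i,S}\ge 0\quad\forall (i,S)\in\mathcal I_{\mathcal S}.\tag{$*$}$$ Then the closure of $\mathcal P_{\mathrm{MDM}}(\mathcal S)$ is the set of all $\boldsymbol x_{\mathcal S}$ for which some $\boldsymbol\lambda$ satisfies $(*)$, and $$\mathcal L(\boldsymbol p_{\mathcal S})=\min_{\boldsymbol x_{\mathcal S},\,\boldsymbol\lambda}\Big\{\sum_{S\in\mathcal S}\mathrm{loss}_S(\boldsymbol p_S,\boldsymbol x_S)\ :\ (\boldsymbol x_{\mathcal S},\boldsymbol\lambda)\text{ satisfies }(*)\Big\},$$ where the minimum is attained. -/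

import Mathlib

open MeasureTheory
open scoped ENNReal

noncomputable section

namespace MDM

/-- The regularity required of the marginal law `μ` of each random term: it is an absolutely
continuous probability law on the line with finite first absolute moment, and its distribution
function is strictly increasing on its support. -/
structure RegularMarginal (μ : Measure ℝ) : Prop where
  isProbabilityMeasure : IsProbabilityMeasure μ
  absolutelyContinuous : μ ≪ volume
  strictMonoOn_cdf : StrictMonoOn (ProbabilityTheory.cdf μ) μ.support
  integrable : Integrable (fun t : ℝ => t) μ

/-- The joint laws of `(ε₁, …, εₙ)` with prescribed marginals `F₁, …, Fₙ`. -/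
def jointLaws {n : ℕ} (F : Fin n → Measure ℝ) : Set (Measure (Fin n → ℝ)) :=
  {θ | IsProbabilityMeasure θ ∧ ∀ i, θ.map (fun ε => ε i) = F i}

/-- The expected maximal utility `E_θ [max_{i ∈ S} (ν i + ε i)]` offered by the assortment `S`. -/
def expectedMax {n : ℕ} (ν : Fin n → ℝ) (S : Finset (Fin n)) (θ : Measure (Fin n → ℝ)) : ℝ :=
  ∫ ε, (⨆ i : {i // i ∈ S}, (ν i + ε i)) ∂θ

/-- The probability under `θ` that product `i` is the utility maximizer in `S`. -/
def choiceProb {n : ℕ} (ν : Fin n → ℝ) (S : Finset (Fin n)) (θ : Measure (Fin n → ℝ))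
    (i : Fin n) : ℝ :=
  θ.real {ε | ∀ j ∈ S, j ≠ i → ν j + ε j < ν i + ε i}

/-- Families `(x_{i,S} : i ∈ S, S ∈ 𝒮)` of reals indexed by the product-assortment pairs of an
assortment collection `𝒮`, with the product topology. -/
abbrev Collection {n : ℕ} (𝒮 : Finset (Finset (Fin n))) : Type :=
  ∀ S : {S // S ∈ 𝒮}, {i // i ∈ S.1} → ℝ

/-- The collections that are representable by a marginal distribution model: a single choice of
marginals and deterministic utilities yields, for every assortment, the given numbers as choice
probabilities under a joint law that maximizes the expected maximal utility. -/
def representable {n : ℕ} (𝒮 : Finset (Finset (Fin n))) : Set (Collection 𝒮) :=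
  {x | ∃ (F : Fin n → Measure ℝ) (ν : Fin n → ℝ),
    (∀ i, RegularMarginal (F i)) ∧
    ∀ S : {S // S ∈ 𝒮}, ∃ θ ∈ jointLaws F, IsMaxOn (expectedMax ν S.1) (jointLaws F) θ ∧
      ∀ i : {i // i ∈ S.1}, x S i = choiceProb ν S.1 θ i}

/-- The loss of a collection `x` with respect to the data `p`, summed over the assortments. -/
def totalLoss {n : ℕ} {𝒮 : Finset (Finset (Fin n))}
    (loss : ∀ S : {S // S ∈ 𝒮}, ({i // i ∈ S.1} → ℝ) → ({i // i ∈ S.1} → ℝ) → ℝ≥0∞)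
    (p x : Collection 𝒮) : ℝ≥0∞ :=
  ∑ S, loss S (p S) (x S)

/-- The limit of MDM: the infimum of the loss over the representable collections. -/
def limitMDM {n : ℕ} {𝒮 : Finset (Finset (Fin n))}
    (loss : ∀ S : {S // S ∈ 𝒮}, ({i // i ∈ S.1} → ℝ) → ({i // i ∈ S.1} → ℝ) → ℝ≥0∞)
    (p : Collection 𝒮) : ℝ≥0∞ :=
  ⨅ x ∈ representable 𝒮, totalLoss loss p x

/-- The constraints on `(x, lam)`: order constraints and simplex constraints. -/
structure Feasible {n : ℕ} {𝒮 : Finset (Finset (Fin n))} (x : Collection 𝒮)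
    (lam : {S // S ∈ 𝒮} → ℝ) : Prop where
  order : ∀ (S T : {S // S ∈ 𝒮}) (i : Fin n) (hS : i ∈ S.1) (hT : i ∈ T.1),
    lam S ≤ lam T → x S ⟨i, hS⟩ ≥ x T ⟨i, hT⟩
  sum_eq_one : ∀ S, ∑ i, x S i = 1
  nonneg : ∀ S i, 0 ≤ x S i

end MDM

end

/-!
For a fixed assortment `S`, the inequality `max_i u_i ≤ lam + ∑_i (u_i - lam)⁺` bounds the expected
maximal utility of every joint law by a quantity that depends on the marginals only, with equality
exactly when almost surely a single utility exceeds `lam`. If the tail probabilities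
`P(ν_i + ε_i > lam)`, `i ∈ S`, sum to one, then a coupling in which exactly one of the events
`ν_i + ε_i > lam` occurs attains the bound, so the optimal choice probabilities are these tail
probabilities. They decrease in `lam`, whence the order constraints.

Conversely, given `(x, lam)` satisfying the constraints, each `x_{i,·}` is interpolated along the
ranks of `lam` by a decreasing tail function, which a small perturbation makes strictly decreasing,
hence the tail function of a regular marginal. The multiplier of each assortment is then re-solved
by the intermediate value theorem; the tail probabilities move little, because a sum of monotone
functions controls the increment of each of its terms. As only the ranks of the levels matter, the
feasible set is a finite union of closed sets, hence closed, and the statement on the limit of MDM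
follows from compactness and continuity.
-/

namespace MDM

open Filter ProbabilityTheory Topology

section Preliminaries

theorem isLeast_image_closure {X α : Type*} [TopologicalSpace X] [CompleteLinearOrder α]
    [TopologicalSpace α] [OrderTopology α] {s : Set X} {f : X → α} (hs : IsCompact (closure s))
    (hne : s.Nonempty) (hf : ContinuousOn f (closure s)) :
    IsLeast (f '' closure s) (⨅ x ∈ s, f x) := by
  rw [image_closure_of_isCompact hs hf, ← sInf_image]
  have hglb := isGLB_sInf (f '' s)
  exact ⟨hglb.mem_closure (hne.image f),
    fun _ hy => closure_minimal (fun _ h => hglb.1 h) isClosed_Ici hy⟩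

theorem exists_rank {ι α : Type*} [Fintype ι] [LinearOrder α] (f : ι → α) :
    ∃ r : ι → Fin (Fintype.card ι), ∀ a b, r a ≤ r b ↔ f a ≤ f b := by
  let below (a : ι) : Finset ι := {c | f c < f a}
  have hmem (a c : ι) : c ∈ below a ↔ f c < f a := Finset.mem_filter_univ c
  refine ⟨fun a => ⟨(below a).card, Finset.card_lt_univ_of_notMem (x := a) (by simp [hmem])⟩,
    fun a b => ⟨fun hle => not_lt.1 fun hlt => ?_, fun hle => ?_⟩⟩
  · have hss : below b ⊂ below a := Finset.ssubset_iff_of_subset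
      (fun c hc => (hmem a c).2 (((hmem b c).1 hc).trans hlt)) |>.2
        ⟨b, (hmem a b).2 hlt, by simp [hmem]⟩
    exact (Finset.card_lt_card hss).not_ge hle
  · exact Finset.card_le_card fun c hc => (hmem b c).2 (((hmem a c).1 hc).trans_le hle)

theorem exists_antitone_eq {ι α : Type*} [Finite ι] [LinearOrder α] {a : ι → α} {v : ι → ℝ}
    (h : ∀ j k, a j ≤ a k → v k ≤ v j) : ∃ g : α → ℝ, Antitone g ∧ ∀ j, g (a j) = v j := by
  have hfac : v.FactorsThrough a := fun j k hjk => le_antisymm (h k j hjk.ge) (h j k hjk.le)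
  let f : α → ℝ := Function.extend a v 0
  have hf (j : ι) : f (a j) = v j := hfac.extend_apply 0 j
  have hanti : AntitoneOn f (Set.range a) := by
    rintro _ ⟨j, rfl⟩ _ ⟨k, rfl⟩ hjk
    simpa only [hf] using h j k hjk
  have hfin : (f '' Set.range a).Finite := (Set.finite_range a).image f
  obtain ⟨g, hg, heq⟩ := hanti.exists_antitone_extension hfin.bddBelow hfin.bddAbove
  exact ⟨g, hg, fun j => (heq ⟨j, rfl⟩).symm.trans (hf j)⟩

theorem abs_sub_le_abs_sum_sub {α κ : Type*} [LinearOrder α] {s : Finset κ} {G : κ → α → ℝ}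
    (hG : ∀ i ∈ s, Antitone (G i)) (a b : α) {i : κ} (hi : i ∈ s) :
    |G i a - G i b| ≤ |∑ j ∈ s, G j a - ∑ j ∈ s, G j b| := by
  wlog hab : a ≤ b generalizing a b
  · simpa only [abs_sub_comm] using this b a (le_of_not_ge hab)
  have hnn : ∀ j ∈ s, 0 ≤ G j a - G j b := fun j hj => sub_nonneg.2 (hG j hj hab)
  rw [← Finset.sum_sub_distrib, abs_of_nonneg (hnn i hi), abs_of_nonneg (Finset.sum_nonneg hnn)]
  exact Finset.single_le_sum hnn hi

theorem integrable_ciSup {ι Ω : Type*} [Finite ι] [MeasurableSpace Ω] {μ : Measure Ω}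
    {f : ι → Ω → ℝ} (hf : ∀ i, Integrable (f i) μ) : Integrable (fun ω => ⨆ i, f i ω) μ := by
  have := Fintype.ofFinite ι
  cases isEmpty_or_nonempty ι
  · simp [Real.iSup_of_isEmpty]
  refine (integrable_finsetSum Finset.univ fun i _ => (hf i).norm).mono'
    (AEMeasurable.iSup fun i => (hf i).aemeasurable).aestronglyMeasurable (ae_of_all _ fun ω => ?_)
  obtain ⟨i, hi⟩ := exists_eq_ciSup_of_finite (f := fun i => f i ω)
  rw [← hi]
  exact Finset.single_le_sum (f := fun i => ‖f i ω‖) (fun _ _ => norm_nonneg _) (Finset.mem_univ i)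

end Preliminaries

section Excess

variable {ι : Type*} [Fintype ι] {u : ι → ℝ} {lam : ℝ}

theorem ciSup_le_add_sum_max [Nonempty ι] (u : ι → ℝ) (lam : ℝ) :
    ⨆ i, u i ≤ lam + ∑ i, max (u i - lam) 0 := by
  refine ciSup_le fun i => ?_
  have hsingle := Finset.single_le_sum (f := fun j => max (u j - lam) 0)
    (fun _ _ => le_max_right _ _) (Finset.mem_univ i)
  linarith [le_max_left (u i - lam) 0]

theorem ciSup_eq_add_sum_max (h : ∃! i, lam < u i) :
    ⨆ i, u i = lam + ∑ i, max (u i - lam) 0 := by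
  obtain ⟨i, hi, huniq⟩ := h
  have : Nonempty ι := ⟨i⟩
  refine le_antisymm (ciSup_le_add_sum_max u lam) ?_
  rw [Finset.sum_eq_single_of_mem i (Finset.mem_univ i) fun j _ hj =>
    max_eq_right (sub_nonpos.2 (not_lt.1 fun hlt => hj (huniq j hlt))),
    max_eq_left (sub_nonneg.2 hi.le), add_sub_cancel]
  exact le_ciSup (Set.finite_range u).bddAbove i

theorem existsUnique_lt_of_ciSup_eq [Nonempty ι] (hne : ∀ i, u i ≠ lam)
    (h : ⨆ i, u i = lam + ∑ i, max (u i - lam) 0) : ∃! i, lam < u i := by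
  have hnn (j : ι) : 0 ≤ max (u j - lam) 0 := le_max_right _ _
  obtain ⟨i, hi⟩ := exists_eq_ciSup_of_finite (f := u)
  have hlt : lam < u i := by
    refine (hne i).symm.lt_of_le ?_
    rw [hi, h]
    exact le_add_of_nonneg_right (Finset.sum_nonneg fun j _ => hnn j)
  refine ⟨i, hlt, fun j hj => by_contra fun hji => ?_⟩
  have hpair := Finset.add_le_sum (fun k _ => hnn k) (Finset.mem_univ i) (Finset.mem_univ j)
    (Ne.symm hji)
  linarith [le_max_left (u i - lam) 0, le_max_left (u j - lam) 0]

theorem forall_ne_lt_iff_of_existsUnique_lt {ι : Type*} {u : ι → ℝ} {lam : ℝ}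
    (h : ∃! k, lam < u k) (i : ι) : (∀ j, j ≠ i → u j < u i) ↔ lam < u i := by
  obtain ⟨k, hk, huniq⟩ := h
  refine ⟨fun hi => ?_, fun hi j hj => lt_of_not_ge fun hij => hj ?_⟩
  · obtain rfl | hki := eq_or_ne k i
    exacts [hk, hk.trans (hi k hki)]
  · rw [huniq i hi, huniq j (hi.trans_le hij)]

end Excess

section Coupling

variable {ι : Type*} [Fintype ι] {Ω : ι → Type*} [∀ i, MeasurableSpace (Ω i)]
  {μ : ∀ i, Measure (Ω i)} {A : ∀ i, Set (Ω i)}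

open Classical in
/-- The law of `ε` obtained by drawing an index `i` with probability `μ i (A i)` and then, for every
`j` independently, `ε j` from `μ j` conditioned on `A j` if `j = i` and on `(A j)ᶜ` otherwise. When
the events `A i` have total probability one, this couples the laws `μ i` so that exactly one of the
events occurs. -/
noncomputable def exclusiveCoupling (μ : ∀ i, Measure (Ω i)) (A : ∀ i, Set (Ω i)) :
    Measure (∀ i, Ω i) :=
  ∑ i, μ i (A i) • Measure.pi fun j => (μ j)[|if j = i then A j else (A j)ᶜ]

theorem ae_existsUnique_exclusiveCoupling (hA : ∀ i, MeasurableSet (A i)) :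
    ∀ᵐ ε ∂exclusiveCoupling μ A, ∃! i, ε i ∈ A i := by
  classical
  have hae (i : ι) : ∀ᵐ ε ∂Measure.pi fun j => (μ j)[|if j = i then A j else (A j)ᶜ],
      ∃! i, ε i ∈ A i := by
    have hj (j : ι) : ∀ᵐ ε ∂Measure.pi fun j => (μ j)[|if j = i then A j else (A j)ᶜ],
        ε j ∈ if j = i then A j else (A j)ᶜ :=
      Measure.tendsto_eval_ae_ae.eventually <|
        ae_cond_mem (by split_ifs; exacts [hA j, (hA j).compl])
    filter_upwards [ae_all_iff.2 hj] with ε hε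
    refine ⟨i, by simpa using hε i, fun j hj => by_contra fun hji => ?_⟩
    have hmem := hε j
    rw [if_neg hji] at hmem
    exact hmem hj
  rw [exclusiveCoupling, ae_iff, Measure.finsetSum_apply]
  exact Finset.sum_eq_zero fun i _ => Measure.ae_smul_measure (hae i) _

variable [∀ i, IsProbabilityMeasure (μ i)]

theorem sum_erase_measure_eq_measure_compl [DecidableEq ι] (hA : ∀ i, MeasurableSet (A i))
    (hsum : ∑ i, μ i (A i) = 1) (j : ι) :
    ∑ i ∈ Finset.univ.erase j, μ i (A i) = μ j (A j)ᶜ := by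
  rw [prob_compl_eq_one_sub (hA j), ← hsum, ← Finset.add_sum_erase _ _ (Finset.mem_univ j),
    ENNReal.add_sub_cancel_left (measure_ne_top _ _)]

open Classical in
theorem isProbabilityMeasure_cond_ite (hA : ∀ i, MeasurableSet (A i))
    (hsum : ∑ i, μ i (A i) = 1) {i : ι} (hi : μ i (A i) ≠ 0) (j : ι) :
    IsProbabilityMeasure (μ j)[|if j = i then A j else (A j)ᶜ] := by
  refine cond_isProbabilityMeasure ?_
  split_ifs with hji
  · exact hji ▸ hi
  · rw [← sum_erase_measure_eq_measure_compl hA hsum j]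
    exact fun h => hi (Finset.sum_eq_zero_iff.1 h i (by simp [Ne.symm hji]))

theorem map_eval_exclusiveCoupling (hA : ∀ i, MeasurableSet (A i))
    (hsum : ∑ i, μ i (A i) = 1) (j : ι) :
    (exclusiveCoupling μ A).map (Function.eval j) = μ j := by
  classical
  have hterm (i : ι) : (μ i (A i) • Measure.pi fun k =>
      (μ k)[|if k = i then A k else (A k)ᶜ]).map (Function.eval j) =
        μ i (A i) • (μ j)[|if j = i then A j else (A j)ᶜ] := by
    by_cases hi : μ i (A i) = 0
    · simp only [hi, zero_smul, Measure.map_zero]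
    · have := isProbabilityMeasure_cond_ite hA hsum hi
      rw [Measure.map_smul, (measurePreserving_eval _ j).map_eq]
  have hne : ∀ i ∈ Finset.univ.erase j, μ i (A i) • (μ j)[|if j = i then A j else (A j)ᶜ] =
      μ i (A i) • (μ j)[|(A j)ᶜ] := fun i hi => by
    rw [if_neg (Finset.ne_of_mem_erase hi).symm]
  rw [exclusiveCoupling, Measure.map_finset_sum' (measurable_pi_apply j).aemeasurable,
    Finset.sum_congr rfl fun i _ => hterm i, ← Finset.add_sum_erase _ _ (Finset.mem_univ j),
    Finset.sum_congr rfl hne, ← Finset.sum_smul, sum_erase_measure_eq_measure_compl hA hsum,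
    if_pos rfl]
  ext t
  simpa only [Measure.add_apply, Measure.smul_apply, smul_eq_mul, mul_comm] using
    cond_add_cond_compl_eq (hA j) (μ j)

theorem isProbabilityMeasure_exclusiveCoupling (hA : ∀ i, MeasurableSet (A i))
    (hsum : ∑ i, μ i (A i) = 1) : IsProbabilityMeasure (exclusiveCoupling μ A) := by
  have : Nonempty ι := by
    by_contra! hempty
    simp at hsum
  obtain ⟨j⟩ := this
  rw [← Measure.isProbabilityMeasure_map_iff (measurable_pi_apply j).aemeasurable]
  exact (map_eval_exclusiveCoupling hA hsum j).symm ▸ inferInstance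

end Coupling

section Duality

variable {n : ℕ} {F : Fin n → Measure ℝ} {ν : Fin n → ℝ} {S : Finset (Fin n)} {lam : ℝ}
  {θ : Measure (Fin n → ℝ)}

/-- The probability that the utility `ν i + ε i` of product `i` exceeds the level `lam`; it only
depends on the marginal of `ε i`. -/
noncomputable def exceedance (F : Fin n → Measure ℝ) (ν : Fin n → ℝ) (lam : ℝ) (i : Fin n) : ℝ :=
  (F i).real (Set.Ioi (lam - ν i))

/-- The Lagrange multipliers of the assortment `S`: the levels whose exceedance probabilities sum
to one, which is the stationarity condition of `dualObjective`. -/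
def IsMultiplier (F : Fin n → Measure ℝ) (ν : Fin n → ℝ) (S : Finset (Fin n)) (lam : ℝ) : Prop :=
  ∑ i ∈ S, exceedance F ν lam i = 1

/-- The objective `lam + ∑ i ∈ S, E (ν i + ε i - lam)⁺` of the dual of the problem of maximizing
`expectedMax ν S` over the joint laws with marginals `F`. -/
noncomputable def dualObjective (F : Fin n → Measure ℝ) (ν : Fin n → ℝ) (S : Finset (Fin n))
    (lam : ℝ) : ℝ :=
  lam + ∑ i : {i // i ∈ S}, ∫ t, max (ν i + t - lam) 0 ∂(F i)

theorem measureReal_setOf_lt_eq_exceedance (hθ : θ ∈ jointLaws F) (ν : Fin n → ℝ) (lam : ℝ)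
    (i : Fin n) : θ.real {ε | lam < ν i + ε i} = exceedance F ν lam i := by
  rw [exceedance, ← hθ.2 i, map_measureReal_apply (measurable_pi_apply i) measurableSet_Ioi]
  simp only [Set.preimage_ofPred_eq, Set.Ioi, sub_lt_iff_lt_add']

theorem ae_add_eval_ne (hF : ∀ i, RegularMarginal (F i)) (hθ : θ ∈ jointLaws F) (ν : Fin n → ℝ)
    (lam : ℝ) (i : Fin n) : ∀ᵐ ε ∂θ, ν i + ε i ≠ lam := by
  have hne : ∀ᵐ t ∂F i, t ≠ lam - ν i :=
    (hF i).absolutelyContinuous.ae_le (Measure.ae_ne volume _)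
  rw [← hθ.2 i] at hne
  filter_upwards [ae_of_ae_map (measurable_pi_apply i).aemeasurable hne] with ε hε h
  exact hε (eq_sub_of_add_eq' h)

theorem integrable_add_eval (hF : ∀ i, RegularMarginal (F i)) (hθ : θ ∈ jointLaws F)
    (ν : Fin n → ℝ) (i : Fin n) : Integrable (fun ε : Fin n → ℝ => ν i + ε i) θ := by
  have := hθ.1
  have hint := (hF i).integrable
  rw [← hθ.2 i] at hint
  exact (integrable_const _).add (hint.comp_measurable (measurable_pi_apply i))

theorem integrable_max_sub (hF : ∀ i, RegularMarginal (F i)) (hθ : θ ∈ jointLaws F)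
    (ν : Fin n → ℝ) (lam : ℝ) (i : Fin n) :
    Integrable (fun ε : Fin n → ℝ => max (ν i + ε i - lam) 0) θ :=
  have := hθ.1
  ((integrable_add_eval hF hθ ν i).sub (integrable_const lam)).pos_part

theorem integrable_add_sum_max (hF : ∀ i, RegularMarginal (F i)) (hθ : θ ∈ jointLaws F)
    (ν : Fin n → ℝ) (S : Finset (Fin n)) (lam : ℝ) :
    Integrable (fun ε : Fin n → ℝ => lam + ∑ i : {i // i ∈ S}, max (ν i + ε i - lam) 0) θ :=
  have := hθ.1
  (integrable_const lam).add (integrable_finsetSum _ fun i _ => integrable_max_sub hF hθ ν lam i)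

theorem integral_add_sum_max (hF : ∀ i, RegularMarginal (F i)) (hθ : θ ∈ jointLaws F)
    (ν : Fin n → ℝ) (S : Finset (Fin n)) (lam : ℝ) :
    ∫ ε, (lam + ∑ i : {i // i ∈ S}, max (ν i + ε i - lam) 0) ∂θ = dualObjective F ν S lam := by
  have := hθ.1
  have hint (i : {i // i ∈ S}) := integrable_max_sub hF hθ ν lam i
  have hmarginal (i : {i // i ∈ S}) :
      ∫ ε, max (ν i + ε i - lam) 0 ∂θ = ∫ t, max (ν i + t - lam) 0 ∂(F i) := by
    rw [← hθ.2 i, integral_map (measurable_pi_apply _).aemeasurable]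
    exact Continuous.aestronglyMeasurable (by fun_prop)
  rw [integral_add (integrable_const _) (integrable_finsetSum _ fun i _ => hint i),
    integral_finsetSum _ fun i _ => hint i, integral_const, probReal_univ, one_smul,
    Finset.sum_congr rfl fun i _ => hmarginal i, dualObjective]

theorem expectedMax_le_dualObjective (hF : ∀ i, RegularMarginal (F i)) (hθ : θ ∈ jointLaws F)
    (ν : Fin n → ℝ) (hS : S.Nonempty) (lam : ℝ) :
    expectedMax ν S θ ≤ dualObjective F ν S lam := by
  have : Nonempty {i // i ∈ S} := hS.to_subtype
  rw [← integral_add_sum_max hF hθ]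
  exact integral_mono (integrable_ciSup fun i : {i // i ∈ S} => integrable_add_eval hF hθ ν i)
    (integrable_add_sum_max hF hθ ν S lam) fun ε => ciSup_le_add_sum_max _ _

theorem expectedMax_eq_dualObjective_iff (hF : ∀ i, RegularMarginal (F i)) (hθ : θ ∈ jointLaws F)
    (hS : S.Nonempty) : expectedMax ν S θ = dualObjective F ν S lam ↔
      ∀ᵐ ε ∂θ, ∃! i : {i // i ∈ S}, lam < ν i + ε i := by
  have : Nonempty {i // i ∈ S} := hS.to_subtype
  rw [← integral_add_sum_max hF hθ, expectedMax, integral_eq_iff_of_ae_le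
    (integrable_ciSup fun i : {i // i ∈ S} => integrable_add_eval hF hθ ν i)
    (integrable_add_sum_max hF hθ ν S lam) (ae_of_all _ fun ε => ciSup_le_add_sum_max _ _)]
  refine eventually_congr ?_
  filter_upwards [ae_all_iff.2 (ae_add_eval_ne hF hθ ν lam)] with ε hε
  exact ⟨existsUnique_lt_of_ciSup_eq fun i => hε i, ciSup_eq_add_sum_max⟩

theorem IsMultiplier.nonempty (hlam : IsMultiplier F ν S lam) : S.Nonempty :=
  Finset.nonempty_of_sum_ne_zero (hlam.trans_ne one_ne_zero)

theorem IsMultiplier.exists_ae_existsUnique [∀ i, IsProbabilityMeasure (F i)]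
    (hlam : IsMultiplier F ν S lam) :
    ∃ θ ∈ jointLaws F, ∀ᵐ ε ∂θ, ∃! i : {i // i ∈ S}, lam < ν i + ε i := by
  let A (i : Fin n) : Set ℝ := {t | i ∈ S ∧ lam - ν i < t}
  have hA (i : Fin n) : MeasurableSet (A i) :=
    (MeasurableSet.const _).inter measurableSet_Ioi
  have hmem (i : Fin n) (hi : i ∈ S) : A i = Set.Ioi (lam - ν i) := by simp [A, hi, Set.Ioi]
  have hsum : ∑ i, F i (A i) = 1 := by
    rw [← Finset.sum_subset S.subset_univ fun i _ hi => by simp [A, hi],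
      ← ENNReal.toReal_eq_one_iff, ENNReal.toReal_sum fun i _ => measure_ne_top _ _, ← hlam]
    exact Finset.sum_congr rfl fun i hi => by rw [hmem i hi, exceedance, Measure.real]
  refine ⟨exclusiveCoupling F A, ⟨isProbabilityMeasure_exclusiveCoupling hA hsum,
    map_eval_exclusiveCoupling hA hsum⟩, ?_⟩
  filter_upwards [ae_existsUnique_exclusiveCoupling (μ := F) hA] with ε ⟨i, hi, huniq⟩
  exact ⟨⟨i, hi.1⟩, sub_lt_iff_lt_add'.1 hi.2,
    fun j hj => Subtype.ext (huniq j ⟨j.2, sub_lt_iff_lt_add'.2 hj⟩)⟩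

theorem IsMultiplier.isMaxOn_expectedMax_iff (hF : ∀ i, RegularMarginal (F i))
    (hlam : IsMultiplier F ν S lam) (hθ : θ ∈ jointLaws F) :
    IsMaxOn (expectedMax ν S) (jointLaws F) θ ↔
      ∀ᵐ ε ∂θ, ∃! i : {i // i ∈ S}, lam < ν i + ε i := by
  have : ∀ i, IsProbabilityMeasure (F i) := fun i => (hF i).isProbabilityMeasure
  rw [← expectedMax_eq_dualObjective_iff hF hθ hlam.nonempty]
  refine ⟨fun hmax => ?_, fun heq θ' hθ' => ?_⟩
  · obtain ⟨θ', hθ', hae⟩ := hlam.exists_ae_existsUnique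
    refine le_antisymm (expectedMax_le_dualObjective hF hθ ν hlam.nonempty lam) ?_
    exact ((expectedMax_eq_dualObjective_iff hF hθ' hlam.nonempty).2 hae).ge.trans (hmax hθ')
  · exact (expectedMax_le_dualObjective hF hθ' ν hlam.nonempty lam).trans heq.ge

theorem choiceProb_eq_exceedance (hθ : θ ∈ jointLaws F)
    (h : ∀ᵐ ε ∂θ, ∃! i : {i // i ∈ S}, lam < ν i + ε i) {i : Fin n} (hi : i ∈ S) :
    choiceProb ν S θ i = exceedance F ν lam i := by
  rw [← measureReal_setOf_lt_eq_exceedance hθ, choiceProb]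
  refine measureReal_congr ?_
  filter_upwards [h] with ε hε
  have hiff := forall_ne_lt_iff_of_existsUnique_lt hε ⟨i, hi⟩
  simp only [Subtype.forall, ne_eq, Subtype.mk.injEq] at hiff
  exact propext hiff

theorem choiceProb_eq_one [IsProbabilityMeasure θ] (ν : Fin n → ℝ) (hS : S.card ≤ 1) {i : Fin n}
    (hi : i ∈ S) : choiceProb ν S θ i = 1 := by
  have huniv : {ε : Fin n → ℝ | ∀ j ∈ S, j ≠ i → ν j + ε j < ν i + ε i} = Set.univ :=
    Set.eq_univ_of_forall fun _ j hj hji => absurd (Finset.card_le_one.1 hS j hj i hi) hji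
  rw [choiceProb, huniv, probReal_univ]

end Duality

section Multiplier

variable {n : ℕ} {F : Fin n → Measure ℝ}

theorem antitone_exceedance [∀ i, IsFiniteMeasure (F i)] (ν : Fin n → ℝ) (i : Fin n) :
    Antitone fun lam => exceedance F ν lam i := fun _ _ hle =>
  measureReal_mono (Set.Ioi_subset_Ioi (sub_le_sub_right hle _))

variable [∀ i, IsProbabilityMeasure (F i)]

theorem exceedance_eq_one_sub_cdf (ν : Fin n → ℝ) (lam : ℝ) (i : Fin n) :
    exceedance F ν lam i = 1 - cdf (F i) (lam - ν i) := by
  rw [exceedance, cdf_eq_real, ← Set.compl_Iic, probReal_compl_eq_one_sub measurableSet_Iic]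

theorem tendsto_exceedance_atBot (ν : Fin n → ℝ) (i : Fin n) :
    Tendsto (fun lam => exceedance F ν lam i) atBot (𝓝 1) := by
  simp only [exceedance_eq_one_sub_cdf, sub_eq_add_neg _ (ν i)]
  simpa using ((tendsto_cdf_atBot (F i)).comp
    (tendsto_atBot_add_const_right _ (-ν i) tendsto_id)).const_sub 1

theorem tendsto_exceedance_atTop (ν : Fin n → ℝ) (i : Fin n) :
    Tendsto (fun lam => exceedance F ν lam i) atTop (𝓝 0) := by
  simp only [exceedance_eq_one_sub_cdf, sub_eq_add_neg _ (ν i)]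
  simpa using ((tendsto_cdf_atTop (F i)).comp
    (tendsto_atTop_add_const_right _ (-ν i) tendsto_id)).const_sub 1

theorem continuous_cdf (μ : Measure ℝ) [IsProbabilityMeasure μ] [NullSingletonClass μ] :
    Continuous (cdf μ) := by
  refine continuous_iff_continuousAt.2 fun a => ?_
  rw [(monotone_cdf μ).continuousAt_iff_leftLim_eq_rightLim, StieltjesFunction.rightLim_eq]
  refine le_antisymm ((monotone_cdf μ).leftLim_le le_rfl) ?_
  have hjump := (cdf μ).measure_singleton a
  rw [measure_cdf, measure_singleton] at hjump
  exact sub_nonpos.1 (ENNReal.ofReal_eq_zero.1 hjump.symm)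

variable [∀ i, NullSingletonClass (F i)]

theorem continuous_exceedance (ν : Fin n → ℝ) (i : Fin n) :
    Continuous fun lam => exceedance F ν lam i := by
  simp only [exceedance_eq_one_sub_cdf]
  exact continuous_const.sub ((continuous_cdf (F i)).comp (continuous_id.sub continuous_const))

theorem exists_isMultiplier_of_one_le {ν : Fin n → ℝ} {S : Finset (Fin n)} {lo : ℝ}
    (hlo : 1 ≤ ∑ i ∈ S, exceedance F ν lo i) : ∃ lam, IsMultiplier F ν S lam := by
  have htop : Tendsto (fun lam => ∑ i ∈ S, exceedance F ν lam i) atTop (𝓝 (∑ _i ∈ S, 0)) :=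
    tendsto_finsetSum _ fun i _ => tendsto_exceedance_atTop ν i
  exact mem_range_of_exists_le_of_exists_ge
    (continuous_finsetSum _ fun i _ => continuous_exceedance ν i)
    (htop.eventually_le_const (by simp)).exists ⟨lo, hlo⟩

theorem exists_isMultiplier_of_one_lt_card (ν : Fin n → ℝ) {S : Finset (Fin n)}
    (hS : 1 < S.card) : ∃ lam, IsMultiplier F ν S lam := by
  have hbot : Tendsto (fun lam => ∑ i ∈ S, exceedance F ν lam i) atBot (𝓝 (∑ _i ∈ S, 1)) :=
    tendsto_finsetSum _ fun i _ => tendsto_exceedance_atBot ν i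
  obtain ⟨lo, hlo⟩ := (hbot.eventually_const_le (u := 1) (by simpa using hS)).exists
  exact exists_isMultiplier_of_one_le hlo

theorem exists_isMultiplier_near {ν : Fin n → ℝ} {S : Finset (Fin n)} {y : {i // i ∈ S} → ℝ}
    {lo t e : ℝ} (hlo : 1 ≤ ∑ i ∈ S, exceedance F ν lo i) (hy : ∑ i, y i = 1)
    (hye : ∀ i : {i // i ∈ S}, |exceedance F ν t i - y i| ≤ e) :
    ∃ lam, IsMultiplier F ν S lam ∧
      ∀ i : {i // i ∈ S}, |exceedance F ν lam i - y i| ≤ (S.card + 1) * e := by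
  obtain ⟨lam, hlam⟩ := exists_isMultiplier_of_one_le hlo
  refine ⟨lam, hlam, fun i => ?_⟩
  have hsum : |1 - ∑ j ∈ S, exceedance F ν t j| ≤ S.card * e := by
    rw [← hy, ← Finset.sum_coe_sort S fun j => exceedance F ν t j, ← Finset.sum_sub_distrib]
    refine (Finset.abs_sum_le_sum_abs _ _).trans
      ((Finset.sum_le_card_nsmul _ _ e fun j _ => ?_).trans (by simp))
    exact (abs_sub_comm _ _).trans_le (hye j)
  have hmono := abs_sub_le_abs_sum_sub (s := S) (fun j _ => antitone_exceedance (F := F) ν j)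
    lam t i.2
  rw [show ∑ j ∈ S, exceedance F ν lam j = 1 from hlam] at hmono
  calc |exceedance F ν lam i - y i|
      ≤ |exceedance F ν lam i - exceedance F ν t i| + |exceedance F ν t i - y i| :=
        abs_sub_le _ _ _
    _ ≤ S.card * e + e := add_le_add (hmono.trans hsum) (hye i)
    _ = (S.card + 1) * e := by ring

end Multiplier


section StepLaw

variable {h : ℕ → ℝ} {N : ℕ}

/-- The measure on `[0, N]` with density `h k - h (k + 1)` on `(k, k + 1]`. When `h` decreases from
`h 0 = 1` to `h N = 0`, it is a probability law with tail probability `h k` at each `k ≤ N`. -/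
noncomputable def stepLaw (h : ℕ → ℝ) (N : ℕ) : Measure ℝ :=
  ∑ k ∈ Finset.range N,
    ENNReal.ofReal (h k - h (k + 1)) • volume.restrict (Set.Ioc (k : ℝ) (k + 1))

theorem stepLaw_apply {s : Set ℝ} (hs : MeasurableSet s) :
    stepLaw h N s = ∑ k ∈ Finset.range N,
      ENNReal.ofReal (h k - h (k + 1)) * volume (s ∩ Set.Ioc (k : ℝ) (k + 1)) := by
  simp only [stepLaw, Measure.finsetSum_apply, Measure.smul_apply, smul_eq_mul,
    Measure.restrict_apply hs]

theorem sum_Ico_ofReal_sub_succ (hh : Antitone h) {j : ℕ} (hj : j ≤ N) :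
    ∑ k ∈ Finset.Ico j N, ENNReal.ofReal (h k - h (k + 1)) = ENNReal.ofReal (h j - h N) := by
  rw [← ENNReal.ofReal_sum_of_nonneg fun k _ => sub_nonneg.2 (hh k.le_succ),
    Finset.sum_Ico_eq_sum_range]
  have htel := Finset.sum_range_sub' (fun k => h (j + k)) (N - j)
  simp only [add_zero, Nat.add_sub_cancel' hj, ← add_assoc] at htel
  rw [htel]

theorem stepLaw_Ioi (hh : Antitone h) {j : ℕ} (hj : j ≤ N) :
    stepLaw h N (Set.Ioi (j : ℝ)) = ENNReal.ofReal (h j - h N) := by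
  rw [stepLaw_apply measurableSet_Ioi, ← Finset.sum_range_add_sum_Ico _ hj,
    ← sum_Ico_ofReal_sub_succ hh hj, Finset.sum_eq_zero, zero_add]
  · refine Finset.sum_congr rfl fun k hk => ?_
    have hjk : (j : ℝ) ≤ k := Nat.cast_le.2 (Finset.mem_Ico.1 hk).1
    simp [Set.inter_comm (Set.Ioi _), Set.Ioc_inter_Ioi, hjk]
  · intro k hk
    have hkj : (k : ℝ) + 1 ≤ j := by exact_mod_cast Finset.mem_range.1 hk
    rw [Set.inter_comm, Set.Ioc_inter_Ioi, Set.Ioc_eq_empty (by simp [hkj]), measure_empty,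
      mul_zero]

theorem stepLaw_univ (hh : Antitone h) : stepLaw h N Set.univ = ENNReal.ofReal (h 0 - h N) := by
  rw [stepLaw_apply MeasurableSet.univ, ← sum_Ico_ofReal_sub_succ hh N.zero_le]
  simp

theorem stepLaw_absolutelyContinuous (h : ℕ → ℝ) (N : ℕ) : stepLaw h N ≪ volume := by
  intro s hs
  rw [stepLaw, Measure.finsetSum_apply]
  exact Finset.sum_eq_zero fun k _ => by
    rw [Measure.smul_apply, Measure.restrict_le_self.absolutelyContinuous hs, smul_zero]

theorem integrable_id_stepLaw (h : ℕ → ℝ) (N : ℕ) : Integrable (fun t : ℝ => t) (stepLaw h N) :=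
  integrable_finsetSum_measure.2 fun k _ =>
    Integrable.smul_measure (μ := volume.restrict (Set.Ioc (k : ℝ) (k + 1)))
      continuous_id.integrableOn_Ioc ENNReal.ofReal_ne_top

theorem stepLaw_Ioc_pos (hh : StrictAnti h) {a b : ℝ} (ha : 0 ≤ a) (hab : a < b) (hb : b ≤ N) :
    0 < stepLaw h N (Set.Ioc a b) := by
  have hfloor := Nat.floor_le ha
  have hfloor' := Nat.lt_floor_add_one a
  have hk : ⌊a⌋₊ ∈ Finset.range N := Finset.mem_range.2 ((Nat.floor_lt ha).2 (hab.trans_le hb))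
  have hvol : 0 < volume (Set.Ioc a b ∩ Set.Ioc (⌊a⌋₊ : ℝ) (⌊a⌋₊ + 1)) := by
    rw [Set.Ioc_inter_Ioc, Real.volume_Ioc, ENNReal.ofReal_pos, sub_pos, sup_eq_left.2 hfloor]
    exact lt_min hab hfloor'
  rw [stepLaw_apply measurableSet_Ioc]
  exact (ENNReal.mul_pos (ENNReal.ofReal_pos.2 (sub_pos.2 (hh ⌊a⌋₊.lt_succ_self))).ne'
    hvol.ne').trans_le (Finset.single_le_sum (f := fun k : ℕ => ENNReal.ofReal (h k - h (k + 1)) *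
      volume (Set.Ioc a b ∩ Set.Ioc (k : ℝ) (k + 1))) (fun _ _ => zero_le) hk)

theorem support_stepLaw_subset (h : ℕ → ℝ) (N : ℕ) :
    (stepLaw h N).support ⊆ Set.Icc 0 (N : ℝ) := by
  refine Measure.support_subset_of_isClosed isClosed_Icc ?_
  rw [mem_ae_iff, stepLaw_apply (MeasurableSet.compl measurableSet_Icc)]
  refine Finset.sum_eq_zero fun k hk => ?_
  have hsub : Set.Ioc (k : ℝ) (k + 1) ⊆ Set.Icc 0 (N : ℝ) := fun t ht =>
    ⟨k.cast_nonneg.trans ht.1.le, ht.2.trans (by exact_mod_cast Finset.mem_range.1 hk)⟩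
  rw [(Set.disjoint_compl_left_iff_subset.2 hsub).inter_eq, measure_empty, mul_zero]

theorem regularMarginal_stepLaw (hh : StrictAnti h) (h0 : h 0 = 1) (hN : h N = 0) :
    RegularMarginal (stepLaw h N) := by
  have : IsProbabilityMeasure (stepLaw h N) := ⟨by simp [stepLaw_univ hh.antitone, h0, hN]⟩
  refine ⟨this, stepLaw_absolutelyContinuous h N, fun a ha b hb hab => ?_,
    integrable_id_stepLaw h N⟩
  have hpos := stepLaw_Ioc_pos hh (support_stepLaw_subset h N ha).1 hab
    (support_stepLaw_subset h N hb).2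
  rwa [← measure_cdf (stepLaw h N), StieltjesFunction.measure_Ioc, ENNReal.ofReal_pos,
    sub_pos] at hpos

theorem exists_antitone_eq_of_mem_Icc {ι : Type*} [Finite ι] {a : ι → ℕ} {v : ι → ℝ}
    (ha : ∀ j, 0 < a j ∧ a j < N) (hv : ∀ j, v j ∈ Set.Icc 0 1)
    (hord : ∀ j k, a j ≤ a k → v k ≤ v j) (hN : 0 < N) :
    ∃ g : ℕ → ℝ, Antitone g ∧ g 0 = 1 ∧ g N = 0 ∧ ∀ j, g (a j) = v j := by
  let a' : ι ⊕ Bool → ℕ := Sum.elim a fun b => cond b 0 N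
  let v' : ι ⊕ Bool → ℝ := Sum.elim v fun b => cond b 1 0
  have hord' : ∀ j k, a' j ≤ a' k → v' k ≤ v' j := by
    rintro (j | _ | _) (k | _ | _) hle
    · exact hord j k hle
    · exact (hv j).1
    · exact absurd hle (ha j).1.not_ge
    · exact absurd hle (ha k).2.not_ge
    · exact le_rfl
    · exact absurd hle hN.not_ge
    · exact (hv k).2
    · exact zero_le_one
    · exact le_rfl
  obtain ⟨g, hg, hgv⟩ := exists_antitone_eq hord'
  exact ⟨g, hg, hgv (Sum.inr true), hgv (Sum.inr false), fun j => hgv (Sum.inl j)⟩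

theorem exists_strictAnti_near {g : ℕ → ℝ} (hg : Antitone g) (hg0 : g 0 = 1)
    (hgN : g N = 0) {e : ℝ} (he : 0 < e) (he1 : e ≤ 1) :
    ∃ h : ℕ → ℝ, StrictAnti h ∧ h 0 = 1 ∧ h N = 0 ∧ ∀ k ≤ N, |h k - g k| ≤ e := by
  have hN : (0 : ℝ) < N := Nat.cast_pos.2 <| Nat.pos_of_ne_zero fun hN => by simp_all
  refine ⟨fun k => (1 - e) * g k + e * (1 - k / N), fun k l hkl => ?_, by simp [hg0],
    by simp [hgN, hN.ne'], fun k hk => ?_⟩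
  · refine add_lt_add_of_le_of_lt (mul_le_mul_of_nonneg_left (hg hkl.le) (sub_nonneg.2 he1)) ?_
    gcongr
  · have hfrac : (k / N : ℝ) ∈ Set.Icc 0 1 :=
      ⟨by positivity, (div_le_one hN).2 (Nat.cast_le.2 hk)⟩
    have hgk : g k ∈ Set.Icc 0 1 := ⟨hgN ▸ hg hk, hg0 ▸ hg k.zero_le⟩
    have hdiff : (1 - e) * g k + e * (1 - k / N) - g k = e * (1 - k / N - g k) := by ring
    rw [hdiff, abs_mul, abs_of_pos he]
    exact mul_le_of_le_one_right he.le
      (abs_le.2 ⟨by linarith [hfrac.2, hgk.2], by linarith [hfrac.1, hgk.1]⟩)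

theorem exists_regularMarginal_near {ι : Type*} [Finite ι] {a : ι → ℕ} {v : ι → ℝ} {e : ℝ}
    (ha : ∀ j, 0 < a j ∧ a j < N) (hv : ∀ j, v j ∈ Set.Icc 0 1)
    (hord : ∀ j k, a j ≤ a k → v k ≤ v j) (hN : 0 < N) (he : 0 < e) (he1 : e ≤ 1) :
    ∃ μ : Measure ℝ, RegularMarginal μ ∧ μ.real (Set.Ioi 0) = 1 ∧
      ∀ j, |μ.real (Set.Ioi (a j : ℝ)) - v j| ≤ e := by
  obtain ⟨g, hg, hg0, hgN, hgv⟩ := exists_antitone_eq_of_mem_Icc ha hv hord hN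
  obtain ⟨h, hh, h0, hN, hhg⟩ := exists_strictAnti_near hg hg0 hgN he he1
  have htail (j : ℕ) (hj : j ≤ N) : (stepLaw h N).real (Set.Ioi (j : ℝ)) = h j := by
    rw [Measure.real, stepLaw_Ioi hh.antitone hj, hN, sub_zero,
      ENNReal.toReal_ofReal (hN ▸ hh.antitone hj)]
  refine ⟨stepLaw h N, regularMarginal_stepLaw hh h0 hN, ?_, fun j => ?_⟩
  · exact_mod_cast (htail 0 N.zero_le).trans h0
  · rw [htail _ (ha j).2.le, ← hgv j]
    exact hhg _ (ha j).2.le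

end StepLaw

section Feasible

variable {n : ℕ} {𝒮 : Finset (Finset (Fin n))} {x : Collection 𝒮} {lam : {S // S ∈ 𝒮} → ℝ}

theorem Feasible.of_le_imp_le {mu : {S // S ∈ 𝒮} → ℝ} (h : Feasible x lam)
    (hle : ∀ S T, mu S ≤ mu T → lam S ≤ lam T) : Feasible x mu :=
  ⟨fun S T i hS hT hST => h.order S T i hS hT (hle S T hST), h.sum_eq_one, h.nonneg⟩

theorem Feasible.mem_stdSimplex (h : Feasible x lam) (S : {S // S ∈ 𝒮}) :
    x S ∈ stdSimplex ℝ {i // i ∈ S.1} :=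
  ⟨h.nonneg S, h.sum_eq_one S⟩

theorem Feasible.nonempty (h : Feasible x lam) (S : {S // S ∈ 𝒮}) : S.1.Nonempty :=
  have ⟨i, _⟩ := Finset.nonempty_of_sum_ne_zero ((h.sum_eq_one S).trans_ne one_ne_zero)
  ⟨i, i.2⟩

theorem exists_feasible_of_antitone {α : Type*} [LinearOrder α] {G : Fin n → α → ℝ}
    (hG : ∀ i, Antitone (G i)) {lev : {S // S ∈ 𝒮} → α} (hx : ∀ S i, x S i = G i (lev S))
    (hmem : ∀ S : {S // S ∈ 𝒮}, x S ∈ stdSimplex ℝ {i // i ∈ S.1}) : ∃ lam, Feasible x lam := by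
  obtain ⟨r, hr⟩ := exists_rank lev
  have horder (S T : {S // S ∈ 𝒮}) (i : Fin n) (hS : i ∈ S.1) (hT : i ∈ T.1)
      (hle : ((r S : ℕ) : ℝ) ≤ (r T : ℕ)) : x S ⟨i, hS⟩ ≥ x T ⟨i, hT⟩ := by
    rw [hx, hx]
    exact hG i ((hr S T).1 (Fin.le_def.2 (Nat.cast_le.1 hle)))
  exact ⟨_, horder, fun S => (hmem S).2, fun S => (hmem S).1⟩

theorem exists_feasible (hne : ∀ S ∈ 𝒮, S.Nonempty) :
    ∃ (x : Collection 𝒮) (lam : {S // S ∈ 𝒮} → ℝ), Feasible x lam := by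
  have hpos (S : {S // S ∈ 𝒮}) : (0 : ℝ) < S.1.card :=
    Nat.cast_pos.2 (Finset.card_pos.2 (hne S.1 S.2))
  refine ⟨fun S _ => (S.1.card : ℝ)⁻¹, fun S => S.1.card, fun S T i _ _ hle => ?_, fun S => ?_,
    fun S i => (inv_pos.2 (hpos S)).le⟩
  · exact inv_anti₀ (hpos S) hle
  · simp [(hpos S).ne']

theorem isClosed_setOf_feasible (lam : {S // S ∈ 𝒮} → ℝ) :
    IsClosed {x : Collection 𝒮 | Feasible x lam} := by
  have heq : {x : Collection 𝒮 | Feasible x lam} =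
      {x | ∀ (S T : {S // S ∈ 𝒮}) (i : Fin n) (hS : i ∈ S.1) (hT : i ∈ T.1),
        lam S ≤ lam T → x T ⟨i, hT⟩ ≤ x S ⟨i, hS⟩} ∩
      ({x | ∀ S, ∑ i, x S i = 1} ∩ {x | ∀ S i, 0 ≤ x S i}) :=
    Set.ext fun x => ⟨fun h => ⟨h.1, h.2, h.3⟩, fun h => ⟨h.1, h.2.1, h.2.2⟩⟩
  rw [heq]
  simp only [Set.ofPred_forall]
  refine .inter ?_ (.inter ?_ ?_)
  · exact isClosed_iInter fun S => isClosed_iInter fun T => isClosed_iInter fun i =>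
      isClosed_iInter fun hS => isClosed_iInter fun hT => isClosed_iInter fun _ =>
        isClosed_le (by fun_prop) (by fun_prop)
  · exact isClosed_iInter fun S => isClosed_eq (by fun_prop) continuous_const
  · exact isClosed_iInter fun S => isClosed_iInter fun i =>
      isClosed_le continuous_const (by fun_prop)

theorem isClosed_setOf_exists_feasible :
    IsClosed {x : Collection 𝒮 | ∃ lam, Feasible x lam} := by
  have heq : {x : Collection 𝒮 | ∃ lam, Feasible x lam} =
      ⋃ r : {S // S ∈ 𝒮} → Fin (Fintype.card {S // S ∈ 𝒮}),
        {x | Feasible x fun S => ((r S : ℕ) : ℝ)} := by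
    ext x
    simp only [Set.mem_iUnion]
    refine ⟨fun ⟨lam, h⟩ => ?_, fun ⟨r, h⟩ => ⟨_, h⟩⟩
    obtain ⟨r, hr⟩ := exists_rank lam
    exact ⟨r, h.of_le_imp_le fun S T hle => (hr S T).1 (Fin.le_def.2 (Nat.cast_le.1 hle))⟩
  rw [heq]
  exact isClosed_iUnion_of_finite fun r => isClosed_setOf_feasible _

theorem isCompact_setOf_exists_feasible :
    IsCompact {x : Collection 𝒮 | ∃ lam, Feasible x lam} :=
  (isCompact_univ_pi fun S : {S // S ∈ 𝒮} =>
    isCompact_stdSimplex ℝ {i // i ∈ S.1}).of_isClosed_subset isClosed_setOf_exists_feasible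
      fun _ ⟨_, h⟩ S _ => h.mem_stdSimplex S

end Feasible

section Representable

variable {n : ℕ} {𝒮 : Finset (Finset (Fin n))} {F : Fin n → Measure ℝ} {ν : Fin n → ℝ}

theorem RegularMarginal.nullSingletonClass {μ : Measure ℝ} (h : RegularMarginal μ) :
    NullSingletonClass μ :=
  ⟨fun _ => h.absolutelyContinuous (measure_singleton _)⟩

theorem mem_representable_of_isMultiplier (hF : ∀ i, RegularMarginal (F i)) {x : Collection 𝒮}
    {lam : {S // S ∈ 𝒮} → ℝ} (hlam : ∀ S, IsMultiplier F ν S.1 (lam S))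
    (hx : ∀ S i, x S i = exceedance F ν (lam S) i) : x ∈ representable 𝒮 := by
  have (i : Fin n) : IsProbabilityMeasure (F i) := (hF i).isProbabilityMeasure
  refine ⟨F, ν, hF, fun S => ?_⟩
  obtain ⟨θ, hθ, hae⟩ := (hlam S).exists_ae_existsUnique
  exact ⟨θ, hθ, ((hlam S).isMaxOn_expectedMax_iff hF hθ).2 hae,
    fun i => (hx S i).trans (choiceProb_eq_exceedance hθ hae i.2).symm⟩

theorem exists_choiceProb_eq_exceedance (hF : ∀ i, RegularMarginal (F i)) {S : Finset (Fin n)}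
    (hS : 1 < S.card) {θ : Measure (Fin n → ℝ)} (hθ : θ ∈ jointLaws F)
    (hmax : IsMaxOn (expectedMax ν S) (jointLaws F) θ) :
    ∃ lam, IsMultiplier F ν S lam ∧ ∀ i ∈ S, choiceProb ν S θ i = exceedance F ν lam i := by
  have (i : Fin n) : IsProbabilityMeasure (F i) := (hF i).isProbabilityMeasure
  have (i : Fin n) : NullSingletonClass (F i) := (hF i).nullSingletonClass
  obtain ⟨lam, hlam⟩ := exists_isMultiplier_of_one_lt_card (F := F) ν hS
  have hae := (hlam.isMaxOn_expectedMax_iff hF hθ).1 hmax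
  exact ⟨lam, hlam, fun i hi => choiceProb_eq_exceedance hθ hae hi⟩

theorem exists_feasible_of_mem_representable (hne : ∀ S ∈ 𝒮, S.Nonempty) {x : Collection 𝒮}
    (hx : x ∈ representable 𝒮) : ∃ lam, Feasible x lam := by
  obtain ⟨F, ν, hF, hrep⟩ := hx
  have (i : Fin n) : IsProbabilityMeasure (F i) := (hF i).isProbabilityMeasure
  -- A singleton assortment has no multiplier when the law of its product has support
  -- unbounded below; it is given the level `⊥`.
  let G (i : Fin n) : WithBot ℝ → ℝ := WithBot.recBotCoe 1 fun lam => exceedance F ν lam i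
  have hG (i : Fin n) : Antitone (G i) :=
    monotone_toDual_comp_iff.1
      (WithBot.monotone_iff.2 ⟨antitone_exceedance ν i, fun _ => measureReal_le_one⟩)
  have hlev (S : {S // S ∈ 𝒮}) :
      ∃ lev, (∀ i, x S i = G i lev) ∧ x S ∈ stdSimplex ℝ {i // i ∈ S.1} := by
    obtain ⟨θ, hθ, hmax, hxθ⟩ := hrep S
    have := hθ.1
    have hnn (i : {i // i ∈ S.1}) : 0 ≤ x S i := hxθ i ▸ measureReal_nonneg
    obtain hS | hS := le_or_gt S.1.card 1
    · have hx1 (i : {i // i ∈ S.1}) : x S i = 1 := (hxθ i).trans (choiceProb_eq_one ν hS i.2)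
      have hcard : S.1.card = 1 := hS.antisymm (Finset.card_pos.2 (hne S.1 S.2))
      exact ⟨⊥, hx1, hnn, by simp [hx1, hcard]⟩
    · obtain ⟨lam, hlam, hprob⟩ := exists_choiceProb_eq_exceedance hF hS hθ hmax
      have hxlam (i : {i // i ∈ S.1}) : x S i = exceedance F ν lam i :=
        (hxθ i).trans (hprob i i.2)
      refine ⟨lam, hxlam, hnn, ?_⟩
      rw [Finset.sum_congr rfl fun i _ => hxlam i, ← hlam]
      exact Finset.sum_coe_sort S.1 (exceedance F ν lam)
  choose lev hlev hmem using hlev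
  exact exists_feasible_of_antitone hG hlev hmem

theorem Feasible.exists_marginals_near {x : Collection 𝒮} {lam : {S // S ∈ 𝒮} → ℝ}
    (h : Feasible x lam) {e : ℝ} (he : 0 < e) (he1 : e ≤ 1) :
    ∃ (F : Fin n → Measure ℝ) (t : {S // S ∈ 𝒮} → ℝ), (∀ i, RegularMarginal (F i)) ∧
      (∀ i, exceedance F 0 0 i = 1) ∧
        ∀ (S) (i : {i // i ∈ S.1}), |exceedance F 0 (t S) i - x S i| ≤ e := by
  obtain ⟨r, hr⟩ := exists_rank lam
  have hmarginal (i : Fin n) := exists_regularMarginal_near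
    (ι := {S : {S // S ∈ 𝒮} // i ∈ S.1}) (a := fun S => r S.1 + 1) (v := fun S => x S.1 ⟨i, S.2⟩)
    (fun S => ⟨Nat.succ_pos _, Nat.succ_lt_succ (r S.1).2⟩)
    (fun S => mem_Icc_of_mem_stdSimplex (h.mem_stdSimplex S.1) _)
    (fun S T hle => h.order S.1 T.1 i S.2 T.2 ((hr _ _).1 (Nat.succ_le_succ_iff.1 hle)))
    (Nat.succ_pos _) he he1
  choose F hF h0 hx using hmarginal
  refine ⟨F, fun S => ((r S + 1 : ℕ) : ℝ), hF, fun i => ?_, fun S i => ?_⟩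
  · simpa only [exceedance, Pi.zero_apply, sub_zero] using h0 i
  · simpa only [exceedance, Pi.zero_apply, sub_zero] using hx i ⟨S, i.2⟩

theorem Feasible.mem_closure_representable {x : Collection 𝒮} {lam : {S // S ∈ 𝒮} → ℝ}
    (h : Feasible x lam) : x ∈ closure (representable 𝒮) := by
  refine Metric.mem_closure_iff.2 fun δ hδ => ?_
  have hn : (0 : ℝ) < n + 2 := by positivity
  obtain ⟨e, he, heδ⟩ := exists_between (lt_min one_pos (div_pos hδ hn))
  obtain ⟨F, t, hF, h0, ht⟩ := h.exists_marginals_near he (heδ.le.trans (min_le_left _ _))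
  have (i : Fin n) : IsProbabilityMeasure (F i) := (hF i).isProbabilityMeasure
  have (i : Fin n) : NullSingletonClass (F i) := (hF i).nullSingletonClass
  have hlo (S : {S // S ∈ 𝒮}) : 1 ≤ ∑ i ∈ S.1, exceedance F 0 0 i := by
    simpa [h0, Nat.one_le_iff_ne_zero] using (h.nonempty S).ne_empty
  choose mu hmu hnear using fun S => exists_isMultiplier_near (hlo S) (h.sum_eq_one S) (ht S)
  refine ⟨fun S i => exceedance F 0 (mu S) i,
    mem_representable_of_isMultiplier hF hmu fun _ _ => rfl, ?_⟩
  refine (dist_pi_lt_iff hδ).2 fun S => (dist_pi_lt_iff hδ).2 fun i => ?_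
  have hcard : (S.1.card : ℝ) ≤ n := Nat.cast_le.2 (card_finset_fin_le S.1)
  calc dist (x S i) (exceedance F 0 (mu S) i)
      = |exceedance F 0 (mu S) i - x S i| := by rw [dist_comm, Real.dist_eq]
    _ ≤ (S.1.card + 1) * e := hnear S i
    _ ≤ (n + 2) * e := by gcongr; linarith
    _ < δ := (lt_div_iff₀' hn).1 (heδ.trans_le (min_le_right _ _))

theorem closure_representable (hne : ∀ S ∈ 𝒮, S.Nonempty) :
    closure (representable 𝒮) = {x : Collection 𝒮 | ∃ lam, Feasible x lam} :=
  Set.Subset.antisymm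
    (closure_minimal (fun _ hx => exists_feasible_of_mem_representable hne hx)
      isClosed_setOf_exists_feasible)
    fun _ ⟨_, h⟩ => h.mem_closure_representable

end Representable

section Limit

variable {n : ℕ} {𝒮 : Finset (Finset (Fin n))}
  {loss : ∀ S : {S // S ∈ 𝒮}, ({i // i ∈ S.1} → ℝ) → ({i // i ∈ S.1} → ℝ) → ℝ≥0∞}
  {p : Collection 𝒮}

theorem continuousOn_totalLoss
    (hloss : ∀ S : {S // S ∈ 𝒮}, ContinuousOn (loss S (p S)) (stdSimplex ℝ {i // i ∈ S.1})) :
    ContinuousOn (totalLoss loss p) {x | ∃ lam, Feasible x lam} :=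
  continuousOn_finsetSum _ fun S _ =>
    (hloss S).comp (continuous_apply S).continuousOn fun _ ⟨_, h⟩ => h.mem_stdSimplex S

theorem isLeast_limitMDM (hne : ∀ S ∈ 𝒮, S.Nonempty)
    (hloss : ∀ S : {S // S ∈ 𝒮}, ContinuousOn (loss S (p S)) (stdSimplex ℝ {i // i ∈ S.1})) :
    IsLeast (totalLoss loss p '' {x | ∃ lam, Feasible x lam}) (limitMDM loss p) := by
  have hcl := closure_representable hne
  have hnonempty : (representable 𝒮).Nonempty :=
    closure_nonempty_iff.1 (hcl ▸ exists_feasible hne)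
  rw [← hcl]
  exact isLeast_image_closure (hcl ▸ isCompact_setOf_exists_feasible) hnonempty
    (hcl ▸ continuousOn_totalLoss hloss)

end Limit

end MDM

theorem proposition4 {n : ℕ} (𝒮 : Finset (Finset (Fin n)))
    (loss : ∀ S : {S // S ∈ 𝒮}, ({i // i ∈ S.1} → ℝ) → ({i // i ∈ S.1} → ℝ) → ℝ≥0∞)
    (p : MDM.Collection 𝒮)
    (hp : ∀ S : {S // S ∈ 𝒮}, p S ∈ stdSimplex ℝ {i // i ∈ S.1})
    (hloss : ∀ S : {S // S ∈ 𝒮}, ContinuousOn (loss S (p S)) (stdSimplex ℝ {i // i ∈ S.1})) :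
    closure (MDM.representable 𝒮) =
        {x : MDM.Collection 𝒮 | ∃ lam : {S // S ∈ 𝒮} → ℝ, MDM.Feasible x lam} ∧
      IsLeast {v : ℝ≥0∞ | ∃ (x : MDM.Collection 𝒮) (lam : {S // S ∈ 𝒮} → ℝ),
        MDM.Feasible x lam ∧ v = MDM.totalLoss loss p x} (MDM.limitMDM loss p) := by
  have hne : ∀ S ∈ 𝒮, S.Nonempty := fun S hS => by
    obtain ⟨i, _⟩ := Finset.nonempty_of_sum_ne_zero ((hp ⟨S, hS⟩).2.trans_ne one_ne_zero)
    exact ⟨i, i.2⟩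
  refine ⟨MDM.closure_representable hne, ?_⟩
  convert MDM.isLeast_limitMDM hne hloss using 1
  ext v
  exact ⟨fun ⟨x, lam, hx, hv⟩ => ⟨x, ⟨lam, hx⟩, hv.symm⟩,
    fun ⟨x, ⟨lam, hx⟩, hv⟩ => ⟨x, lam, hx, hv.symm⟩⟩
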